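/- All graphs are finite and simple, and realizations are labeled (graphs with distinct edge sets are distinct). A graph is a \emph{threshold graph} if there are a real number $t$ and real vertex weights $w$ such that distinct vertices $u,v$ are adjacent if and only if $w(u)+w(v)\ge t$. It is a \emph{difference graph} if there are a real number $t>0$ and real vertex weights $w$ with $|w(v)|<t$ for every vertex $v$ such that distinct vertices $u,v$ are adjacent if and only if $|w(u)-w(v)|\ge t$. The \emph{conjugate} of a descending list $\pi=(\pi_1,\dots,\pi_p)$ of nonnegative integers is the list $\pi^*$ with terms $\pi^*_i=|\{j:\pi_j\ge i\}|$ for $1\le i\le \pi_1$. Let $H$ be a bipartite graph with partite sets $X$ and $Y$ (disjoint sets whose union is the whole vertex set, with every edge joining $X$ to $Y$), where $|X|=p$ and $|Y|=q$, and let $\pi=(\pi_1,\dots,\pi_p)$ and $\rho=(\rho_1,\dots,\rho_q)$ be the lists of degrees in $H$ of the vertices of $X$ and of $Y$, respectively, each in descending order; also assume $\pi_1\le p$. Then the following are equivalent. \begin{enumerate} \item[(0)] $H$ is a difference graph. \item[(1)] $H$ is the only realization of its two degree lists as a bipartite graph with partite sets $X$ and $Y$; that is, every bipartite graph with partite sets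 $X$ and $Y$ in which each vertex has the same degree as in $H$ is equal to $H$. \item[(2)] The graph obtained from $H$ by adding all possible edges between vertices of $X$ is a threshold graph. \item[(2$'$)] The graph obtained from $H$ by adding all possible edges between vertices of $Y$ is a threshold graph. \item[(3)] $\sum_{i=1}^p \pi_i=\sum_{i=1}^q\rho_i$, and $\sum_{i=1}^k\pi_i=\sum_{i=1}^q\min\{k,\rho_i\}$ for each $k\in\{1,\dots,p-1\}$. \item[(4)] $\pi^*=\rho$, where lists that differ only in trailing zeros are identified (that is, $\pi^*$ and $\rho$ have the same Young diagram). \end{enumerate} Moreover, every difference graph is bipartite and has partite sets $X,Y$, covering its vertex set, with $\pi_1\le p$ as above; hence each of the conditions (1), (2), (2$'$), (3), (4) characterizes the class of difference graphs. -/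

import Mathlib

namespace BipartiteDegrees

variable {V : Type*}

/-- A threshold graph: there are a real threshold `t` and real vertex weights `w` such that two
(distinct) vertices are adjacent iff the sum of their weights is at least `t`. -/
def IsThresholdGraph (G : SimpleGraph V) : Prop :=
  ∃ (t : ℝ) (w : V → ℝ), ∀ u v : V, u ≠ v → (G.Adj u v ↔ t ≤ w u + w v)

/-- A difference graph: there are a positive real threshold `t` and real vertex weights `w`, all of
absolute value less than `t`, such that two (distinct) vertices are adjacent iff the absolute value
of the difference of their weights is at least `t`. -/
def IsDifferenceGraph (G : SimpleGraph V) : Prop :=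
  ∃ (t : ℝ) (w : V → ℝ), 0 < t ∧ (∀ v : V, |w v| < t) ∧
    ∀ u v : V, u ≠ v → (G.Adj u v ↔ t ≤ |w u - w v|)

/-- `G` is a bipartite graph with partite sets `X` and `Y`: the sets `X` and `Y` are disjoint, they
cover the vertex set, and every edge of `G` joins a vertex of `X` to a vertex of `Y`. -/
def IsBipartition (G : SimpleGraph V) (X Y : Finset V) : Prop :=
  G.IsBipartiteWith (X : Set V) (Y : Set V) ∧ ∀ v : V, v ∈ X ∨ v ∈ Y

/-- The graph obtained from `G` by adding all possible edges between vertices of `S`. -/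
def augment (G : SimpleGraph V) (S : Finset V) : SimpleGraph V where
  Adj u v := G.Adj u v ∨ (u ≠ v ∧ u ∈ S ∧ v ∈ S)
  symm := ⟨fun _ _ h => h.imp (fun h => h.symm) (fun h => ⟨h.1.symm, h.2.2, h.2.1⟩)⟩
  loopless := ⟨fun v h => h.elim (fun h => G.loopless.irrefl v h) (fun h => h.1 rfl)⟩

/-- The list of the degrees in `G` of the vertices of `S`, in descending order. -/
def degreeList [Fintype V] (G : SimpleGraph V) [DecidableRel G.Adj] (S : Finset V) : List ℕ :=
  (S.val.map fun v => G.degree v).sort (· ≥ ·)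

/-- The conjugate of a descending list `l = (l₁, …, lₜ)`: the list of length `l₁` whose `i`-th term
is the number of `j` with `lⱼ ≥ i`, for `i = 1, …, l₁`. -/
def conjugate (l : List ℕ) : List ℕ :=
  (List.range (l.headD 0)).map fun i => l.countP fun a => decide (i + 1 ≤ a)

/-- Two lists have the same Young diagram: they agree after padding with zeros. -/
def SameDiagram (l m : List ℕ) : Prop :=
  ∀ i : ℕ, l.getD i 0 = m.getD i 0

/-- `G` is the only bipartite graph with partite sets `X` and `Y` in which every vertex has the
same degree as in `G` (labeled realizations: distinct edge sets are distinct realizations). -/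
def IsUniqueRealization [Fintype V] (G : SimpleGraph V) [DecidableRel G.Adj]
    (X Y : Finset V) : Prop :=
  ∀ (G' : SimpleGraph V) [DecidableRel G'.Adj], IsBipartition G' X Y →
    (∀ v : V, G'.degree v = G.degree v) → G' = G

/-- Equality in the Gale–Ryser conditions for the lists `π = (π₁, …, π_p)` and `ρ`. -/
def GaleRyserEquality (π ρ : List ℕ) : Prop :=
  π.sum = ρ.sum ∧
    ∀ k : ℕ, 1 ≤ k → k < π.length → (π.take k).sum = (ρ.map fun r => min k r).sum

end BipartiteDegrees

/-! Every condition is equivalent to one symmetric property, `HasNestedNeighborhoods`: there are no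
edges xy, x'y' with xy' and x'y both missing, where x and x' lie in X. Such an alternating 4-cycle
contradicts the weight inequalities of (0) and (2), and exchanging its edges for its non-edges gives
a second realization, contradicting (1).

Conversely, in a nested graph x and y are adjacent exactly when b(x) < a(y), with a(y) the degree of
y and b(x) the number of vertices of X of degree larger than that of x
(`HasNestedNeighborhoods.adj_iff`). These integers yield the weights for (0) and (2), and also a
linear functional that depends only on degrees and is maximized by H alone, whence (1).

For (3), count the edges leaving the k vertices of X of largest degree: the Gale–Ryser bound is
tight iff this set is comparable with every neighborhood N(y), and this for all k is nestedness.
Taking differences in k turns (3) into (4). -/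

namespace BipartiteDegrees

open Finset

/-! ### Conjugate lists and the Gale–Ryser equalities -/

section Lists

/-- In a descending list, more than `j` terms exceed `i` iff the `j`-th term exceeds `i`. -/
theorem lt_countP_iff_lt_getD {l : List ℕ} (hl : l.Pairwise (· ≥ ·)) (i j : ℕ) :
    j < l.countP (fun a => decide (i + 1 ≤ a)) ↔ i < l.getD j 0 := by
  induction l generalizing j with
  | nil => simp
  | cons a l ih =>
    rw [List.pairwise_cons] at hl
    rw [List.countP_cons]
    by_cases ha : i + 1 ≤ a
    · cases j with
      | zero => simp [ha]; omega
      | succ j => simpa [ha] using ih hl.2 j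
    · have h0 : l.countP (fun a => decide (i + 1 ≤ a)) = 0 := by
        rw [List.countP_eq_zero]
        intro b hb
        have := hl.1 b hb
        simp
        omega
      have hle : ∀ n, l.getD n 0 ≤ a := by
        intro n
        rw [List.getD_eq_getElem?_getD]
        by_cases hn : n < l.length
        · simpa [hn] using hl.1 _ (List.getElem_mem hn)
        · simp [List.getElem?_eq_none (not_lt.mp hn)]
      cases j with
      | zero =>
        simp only [h0, ha, List.getD_cons_zero, decide_false, Bool.false_eq_true, if_false]
        omega
      | succ j =>
        have := hle j
        simp only [h0, ha, List.getD_cons_succ, decide_false, Bool.false_eq_true, if_false]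
        omega

theorem getD_conjugate {l : List ℕ} (hl : l.Pairwise (· ≥ ·)) (i : ℕ) :
    (conjugate l).getD i 0 = l.countP fun a => decide (i + 1 ≤ a) := by
  have h := lt_countP_iff_lt_getD hl i 0
  have hh : l.getD 0 0 = l.headD 0 := by cases l <;> rfl
  rw [hh] at h
  unfold conjugate
  rw [List.getD_eq_getElem?_getD]
  by_cases hi : i < l.headD 0
  · simp only [List.getElem?_map, List.getElem?_range hi, Option.map_some, Option.getD_some]
  · rw [List.getElem?_eq_none (by simpa using hi)]
    simp only [Option.getD_none]
    omega

/-- Conjugation of Young diagrams is an involution: by `lt_countP_iff_lt_getD`, both sides compare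
the diagrams cell by cell. -/
theorem sameDiagram_conjugate_iff {l m : List ℕ} (hl : l.Pairwise (· ≥ ·))
    (hm : m.Pairwise (· ≥ ·)) :
    SameDiagram (conjugate l) m ↔
      ∀ i, l.getD i 0 = m.countP fun a => decide (i + 1 ≤ a) := by
  constructor
  · intro h i
    refine eq_of_forall_lt_iff fun j => ?_
    rw [lt_countP_iff_lt_getD hm, ← h j, getD_conjugate hl, lt_countP_iff_lt_getD hl]
  · intro h i
    refine eq_of_forall_lt_iff fun j => ?_
    rw [getD_conjugate hl, lt_countP_iff_lt_getD hl, h j, lt_countP_iff_lt_getD hm]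

theorem sum_take_eq_sum_range_getD (l : List ℕ) (k : ℕ) :
    (l.take k).sum = ∑ i ∈ range k, l.getD i 0 := by
  induction l generalizing k with
  | nil => simp
  | cons a l ih =>
    cases k with
    | zero => simp
    | succ k => rw [sum_range_succ']; simp [ih, add_comm]

theorem sum_map_min_eq_sum_range_countP (l : List ℕ) (k : ℕ) :
    (l.map fun r => min k r).sum = ∑ i ∈ range k, l.countP fun a => decide (i + 1 ≤ a) := by
  induction k with
  | zero => simp
  | succ k ih =>
    rw [sum_range_succ, ← ih]
    clear ih
    induction l with
    | nil => simp
    | cons a l ih =>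
      simp only [List.map_cons, List.sum_cons, List.countP_cons, ih]
      by_cases ha : k + 1 ≤ a
      · simp [ha]; omega
      · simp [ha]; omega

/-- The two sides of the k-th equality are partial sums of `l` and of the conjugate of `m`, so
equality for all k means equality of terms. -/
theorem galeRyserEquality_iff_sameDiagram_conjugate {l m : List ℕ} (hl : l.Pairwise (· ≥ ·))
    (hm : m.Pairwise (· ≥ ·)) (hsum : l.sum = m.sum) (hle : ∀ r ∈ m, r ≤ l.length) :
    GaleRyserEquality l m ↔ SameDiagram (conjugate l) m := by
  rw [sameDiagram_conjugate_iff hl hm]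
  constructor
  · rintro ⟨-, h⟩
    have key : ∀ k ≤ l.length, ∑ i ∈ range k, l.getD i 0 =
        ∑ i ∈ range k, m.countP fun a => decide (i + 1 ≤ a) := by
      intro k hk
      rw [← sum_take_eq_sum_range_getD, ← sum_map_min_eq_sum_range_countP]
      rcases Nat.eq_zero_or_pos k with rfl | hk0
      · simp
      rcases hk.lt_or_eq with hlt | rfl
      · exact h k hk0 hlt
      -- The case k = `l.length` is the equality of total sums, since truncation at k leaves `m`
      -- unchanged.
      · rw [List.take_length, hsum]
        congr 1
        conv_lhs => rw [← List.map_id m]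
        exact List.map_congr_left fun r hr => (min_eq_right (hle r hr)).symm
    intro i
    by_cases hi : i < l.length
    · have h1 := key i hi.le
      have h2 := key (i + 1) hi
      rw [sum_range_succ, sum_range_succ, h1] at h2
      exact Nat.add_left_cancel h2
    · have h0 : m.countP (fun a => decide (i + 1 ≤ a)) = 0 := by
        rw [List.countP_eq_zero]
        intro b hb
        have := hle b hb
        simp
        omega
      rw [h0, List.getD_eq_getElem?_getD, List.getElem?_eq_none (not_lt.mp hi), Option.getD_none]
  · intro h
    refine ⟨hsum, fun k _ _ => ?_⟩
    rw [sum_take_eq_sum_range_getD, sum_map_min_eq_sum_range_countP]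
    exact sum_congr rfl fun i _ => h i

end Lists

/-! ### Nested neighborhoods and vertex weights -/

section Nested

variable {V : Type*}

/-- The neighborhoods of the vertices of `X` form a chain under inclusion. -/
def HasNestedNeighborhoods (H : SimpleGraph V) (X : Finset V) : Prop :=
  ∀ ⦃x x' y y' : V⦄, x ∈ X → x' ∈ X → H.Adj x y → H.Adj x' y' → H.Adj x y' ∨ H.Adj x' y

theorem IsBipartition.symm {H : SimpleGraph V} {X Y : Finset V} (h : IsBipartition H X Y) :
    IsBipartition H Y X :=
  ⟨h.1.symm, fun v => (h.2 v).symm⟩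

theorem IsBipartition.notMem_left {H : SimpleGraph V} {X Y : Finset V}
    (h : IsBipartition H X Y) {v : V} (hv : v ∈ Y) : v ∉ X :=
  fun hx => Set.disjoint_left.mp h.1.disjoint (mem_coe.mpr hx) (mem_coe.mpr hv)

theorem IsBipartition.notMem_right {H : SimpleGraph V} {X Y : Finset V}
    (h : IsBipartition H X Y) {v : V} (hv : v ∈ X) : v ∉ Y :=
  h.symm.notMem_left hv

theorem IsBipartition.mem_right {H : SimpleGraph V} {X Y : Finset V}
    (h : IsBipartition H X Y) {x y : V} (hx : x ∈ X) (hxy : H.Adj x y) : y ∈ Y := by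
  rcases h.1.mem_of_adj hxy with h' | h'
  · exact mem_coe.mp h'.2
  · exact absurd (mem_coe.mp h'.1) (h.notMem_right hx)

theorem IsBipartition.not_adj_left {H : SimpleGraph V} {X Y : Finset V}
    (h : IsBipartition H X Y) {x x' : V} (hx : x ∈ X) (hx' : x' ∈ X) : ¬ H.Adj x x' :=
  fun hadj => h.notMem_right hx' (h.mem_right hx hadj)

theorem HasNestedNeighborhoods.swap {H : SimpleGraph V} {X Y : Finset V}
    (h : IsBipartition H X Y) (hN : HasNestedNeighborhoods H X) :
    HasNestedNeighborhoods H Y := by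
  intro y y' x x' hy hy' hyx hyx'
  rcases hN (h.symm.mem_right hy hyx) (h.symm.mem_right hy' hyx') hyx.symm hyx'.symm with h | h
  · exact Or.inr h.symm
  · exact Or.inl h.symm

theorem IsDifferenceGraph.hasNestedNeighborhoods {H : SimpleGraph V} {X Y : Finset V}
    (h : IsBipartition H X Y) (hD : IsDifferenceGraph H) : HasNestedNeighborhoods H X := by
  obtain ⟨t, w, ht, -, hw⟩ := hD
  have lt_of_not : ∀ u v, ¬ H.Adj u v → |w u - w v| < t := by
    intro u v huv
    by_cases hne : u = v
    · simpa [hne] using ht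
    · exact not_le.mp fun hle => huv ((hw u v hne).mpr hle)
  intro x x' y y' hx hx' hxy hxy'
  by_contra! hcon
  have h1 := (hw x y hxy.ne).mp hxy
  have h2 := (hw x' y' hxy'.ne).mp hxy'
  have h3 := abs_lt.mp (lt_of_not _ _ hcon.1)
  have h4 := abs_lt.mp (lt_of_not _ _ hcon.2)
  have h5 := abs_lt.mp (lt_of_not _ _ (h.not_adj_left hx hx'))
  have h6 := abs_lt.mp
    (lt_of_not _ _ (h.symm.not_adj_left (h.mem_right hx hxy) (h.mem_right hx' hxy')))
  -- Adding the two differences gives at least 2t. If their signs agree, regroup as the pairs xy',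
  -- x'y; if not, as xx', yy'. All four are non-adjacent pairs, so the sum is below 2t.
  rcases le_abs.mp h1 with h1 | h1 <;> rcases le_abs.mp h2 with h2 | h2 <;> linarith

theorem augment_adj_of_mem_of_mem {H : SimpleGraph V} {X Y : Finset V}
    (h : IsBipartition H X Y) {x y : V} (hy : y ∈ Y) :
    (augment H X).Adj x y ↔ H.Adj x y :=
  ⟨fun hadj => hadj.elim id fun h' => absurd h'.2.2 (h.notMem_left hy), Or.inl⟩

/-- The pairs xy, x'y' have the same total weight as xy', x'y, so the latter cannot both fall below
the threshold. -/
theorem IsThresholdGraph.hasNestedNeighborhoods {H : SimpleGraph V} {X Y : Finset V}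
    (h : IsBipartition H X Y) (hT : IsThresholdGraph (augment H X)) :
    HasNestedNeighborhoods H X := by
  obtain ⟨t, w, hw⟩ := hT
  have key : ∀ x ∈ X, ∀ y ∈ Y, (H.Adj x y ↔ t ≤ w x + w y) := fun x hx y hy =>
    (augment_adj_of_mem_of_mem h hy).symm.trans
      (hw x y fun e => h.notMem_right hx (e ▸ hy))
  intro x x' y y' hx hx' hxy hxy'
  have hy := h.mem_right hx hxy
  have hy' := h.mem_right hx' hxy'
  rw [key x hx y' hy', key x' hx' y hy]
  rw [key x hx y hy] at hxy
  rw [key x' hx' y' hy'] at hxy'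
  by_contra! hcon
  linarith [hcon.1, hcon.2]

variable [Fintype V]

theorem IsBipartition.degree_eq {H : SimpleGraph V} [DecidableRel H.Adj] {X Y : Finset V}
    (h : IsBipartition H X Y) {x : V} (hx : x ∈ X) :
    H.degree x = #{y ∈ Y | H.Adj x y} := by
  rw [← SimpleGraph.card_neighborFinset_eq_degree]
  congr 1
  ext y
  simp only [SimpleGraph.mem_neighborFinset, mem_filter]
  exact ⟨fun hxy => ⟨h.mem_right hx hxy, hxy⟩, And.right⟩

theorem IsBipartition.degree_eq' {H : SimpleGraph V} [DecidableRel H.Adj] {X Y : Finset V}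
    (h : IsBipartition H X Y) {y : V} (hy : y ∈ Y) :
    H.degree y = #{x ∈ X | H.Adj x y} := by
  rw [h.symm.degree_eq hy]
  simp only [H.adj_comm]

theorem HasNestedNeighborhoods.adj_of_degree_le {H : SimpleGraph V} [DecidableRel H.Adj]
    {X : Finset V} (hN : HasNestedNeighborhoods H X) {x x' y : V}
    (hx : x ∈ X) (hx' : x' ∈ X) (hxy : H.Adj x y) (hd : H.degree x ≤ H.degree x') :
    H.Adj x' y := by
  by_contra hcon
  refine hd.not_gt ?_
  rw [← SimpleGraph.card_neighborFinset_eq_degree, ← SimpleGraph.card_neighborFinset_eq_degree]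
  refine card_lt_card ((ssubset_iff_of_subset fun z hz => ?_).mpr ⟨y, ?_, ?_⟩)
  · rw [SimpleGraph.mem_neighborFinset] at hz ⊢
    exact (hN hx hx' hxy hz).resolve_right hcon
  · simpa using hxy
  · simpa using hcon

/-- The neighbors of y are an upper segment of X in the order by degree: a neighbor x brings along
every vertex of larger degree, while a non-neighbor has smaller degree than every neighbor. -/
theorem HasNestedNeighborhoods.adj_iff {H : SimpleGraph V} [DecidableRel H.Adj]
    {X Y : Finset V} (h : IsBipartition H X Y) (hN : HasNestedNeighborhoods H X) {x y : V}
    (hx : x ∈ X) (hy : y ∈ Y) :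
    H.Adj x y ↔ #{x' ∈ X | H.degree x < H.degree x'} < H.degree y := by
  rw [h.degree_eq' hy]
  constructor
  · intro hxy
    refine card_lt_card ((ssubset_iff_of_subset fun z hz => ?_).mpr ⟨x, ?_, ?_⟩)
    · rw [mem_filter] at hz ⊢
      exact ⟨hz.1, hN.adj_of_degree_le hx hz.1 hxy hz.2.le⟩
    · simp [hx, hxy]
    · simp
  · contrapose!
    intro hxy
    refine card_le_card fun z hz => ?_
    rw [mem_filter] at hz ⊢
    exact ⟨hz.1, not_le.mp fun hle => hxy (hN.adj_of_degree_le hz.1 hx hz.2 hle)⟩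

/-- Nested neighborhoods are described by comparing integer weights. -/
theorem HasNestedNeighborhoods.exists_weights {H : SimpleGraph V} {X Y : Finset V}
    (h : IsBipartition H X Y) (hN : HasNestedNeighborhoods H X) :
    ∃ a b : V → ℕ, (∀ v ∈ Y, a v ≤ #X) ∧ (∀ v, b v ≤ #X) ∧
      ∀ x ∈ X, ∀ y ∈ Y, (H.Adj x y ↔ b x < a y) := by
  classical
  refine ⟨fun y => H.degree y, fun x => #{x' ∈ X | H.degree x < H.degree x'}, fun y hy => ?_,
    fun x => card_filter_le _ _, fun x hx y hy => hN.adj_iff h hx hy⟩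
  exact (h.degree_eq' hy).trans_le (card_filter_le _ _)

theorem HasNestedNeighborhoods.isDifferenceGraph {H : SimpleGraph V} {X Y : Finset V}
    (h : IsBipartition H X Y) (hN : HasNestedNeighborhoods H X) : IsDifferenceGraph H := by
  classical
  obtain ⟨a, b, ha, hb, hab⟩ := hN.exists_weights h
  -- Weights lie in [0, #X] on X and in [-#X, 0] on Y, so within a side they differ by less than #X
  -- + 1; across, the difference is #X + a(y) - b(x).
  let w : V → ℝ := fun v => if v ∈ X then (#X : ℝ) - b v else -(a v : ℝ)
  have hwX : ∀ v ∈ X, w v = (#X : ℝ) - b v := fun v hv => if_pos hv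
  have hwY : ∀ v ∈ Y, w v = -(a v : ℝ) := fun v hv => if_neg (h.notMem_left hv)
  have ha' : ∀ v ∈ Y, (a v : ℝ) ≤ #X := fun v hv => by exact_mod_cast ha v hv
  have hb' : ∀ v, (b v : ℝ) ≤ #X := fun v => by exact_mod_cast hb v
  have ha0 : ∀ v, (0 : ℝ) ≤ a v := fun v => Nat.cast_nonneg _
  have hb0 : ∀ v, (0 : ℝ) ≤ b v := fun v => Nat.cast_nonneg _
  have hXY : ∀ x ∈ X, ∀ y ∈ Y, (H.Adj x y ↔ (#X : ℝ) + 1 ≤ |w x - w y|) := by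
    intro x hx y hy
    rw [hab x hx y hy, hwX x hx, hwY y hy,
      abs_of_nonneg (by linarith [hb' x, ha0 y]), ← Nat.succ_le_iff, Nat.succ_eq_add_one,
      ← Nat.cast_le (α := ℝ)]
    push_cast
    constructor <;> intro _ <;> linarith
  refine ⟨#X + 1, w, by positivity, fun v => ?_, fun u v _ => ?_⟩
  · rw [abs_lt]
    rcases h.2 v with hv | hv
    · rw [hwX v hv]
      constructor <;> linarith [hb' v, hb0 v]
    · rw [hwY v hv]
      constructor <;> linarith [ha' v hv, ha0 v]
  · rcases h.2 u with hu | hu <;> rcases h.2 v with hv | hv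
    · refine iff_of_false (h.not_adj_left hu hv) (not_le.mpr ?_)
      rw [hwX u hu, hwX v hv, abs_lt]
      constructor <;> linarith [hb' v, hb0 v, hb' u, hb0 u]
    · exact hXY u hu v hv
    · rw [H.adj_comm, abs_sub_comm]
      exact hXY v hv u hu
    · refine iff_of_false (h.symm.not_adj_left hu hv) (not_le.mpr ?_)
      rw [hwY u hu, hwY v hv, abs_lt]
      constructor <;> linarith [ha' v hv, ha0 v, ha' u hu, ha0 u]

theorem HasNestedNeighborhoods.isThresholdGraph {H : SimpleGraph V} {X Y : Finset V}
    (h : IsBipartition H X Y) (hN : HasNestedNeighborhoods H X) :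
    IsThresholdGraph (augment H X) := by
  classical
  obtain ⟨a, b, ha, hb, hab⟩ := hN.exists_weights h
  -- Weights are at least #X + 1 on X and negative on Y, which settles pairs within a side; across,
  -- the sum is #X + a(y) - b(x).
  let w : V → ℝ := fun v => if v ∈ X then 2 * (#X : ℝ) + 1 - b v else a v - (#X + 1 : ℝ)
  have hwX : ∀ v ∈ X, w v = 2 * (#X : ℝ) + 1 - b v := fun v hv => if_pos hv
  have hwY : ∀ v ∈ Y, w v = a v - (#X + 1 : ℝ) := fun v hv => if_neg (h.notMem_left hv)
  have ha' : ∀ v ∈ Y, (a v : ℝ) ≤ #X := fun v hv => by exact_mod_cast ha v hv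
  have hb' : ∀ v, (b v : ℝ) ≤ #X := fun v => by exact_mod_cast hb v
  have hX0 : (0 : ℝ) ≤ #X := Nat.cast_nonneg _
  have hXY : ∀ x ∈ X, ∀ y ∈ Y, ((augment H X).Adj x y ↔ (#X : ℝ) + 1 ≤ w x + w y) := by
    intro x hx y hy
    rw [augment_adj_of_mem_of_mem h hy, hab x hx y hy, hwX x hx, hwY y hy,
      ← Nat.succ_le_iff, Nat.succ_eq_add_one, ← Nat.cast_le (α := ℝ)]
    push_cast
    constructor <;> intro _ <;> linarith
  refine ⟨#X + 1, w, fun u v huv => ?_⟩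
  rcases h.2 u with hu | hu <;> rcases h.2 v with hv | hv
  · refine iff_of_true (Or.inr ⟨huv, hu, hv⟩) ?_
    rw [hwX u hu, hwX v hv]
    linarith [hb' u, hb' v]
  · exact hXY u hu v hv
  · rw [SimpleGraph.adj_comm, add_comm (w u)]
    exact hXY v hv u hu
  · refine iff_of_false ?_ (not_le.mpr ?_)
    · rw [augment_adj_of_mem_of_mem h hv]
      exact h.symm.not_adj_left hu hv
    · rw [hwY u hu, hwY v hv]
      linarith [ha' u hu, ha' v hv]

/-- The total weight of the edges of a bipartite graph is determined by its degrees. -/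
theorem IsBipartition.sum_edge_weights {G : SimpleGraph V} [DecidableRel G.Adj]
    {X Y : Finset V} (h : IsBipartition G X Y) (f g : V → ℤ) :
    ∑ x ∈ X, ∑ y ∈ Y, (if G.Adj x y then f x + g y else 0) =
      ∑ x ∈ X, G.degree x * f x + ∑ y ∈ Y, G.degree y * g y := by
  have hsplit : ∀ x y, (if G.Adj x y then f x + g y else 0) =
      (if G.Adj x y then f x else 0) + (if G.Adj x y then g y else 0) := by
    intro x y
    split_ifs <;> simp
  simp only [hsplit, sum_add_distrib]
  congr 1
  · refine sum_congr rfl fun x hx => ?_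
    rw [h.degree_eq hx, ← sum_filter, sum_const, nsmul_eq_mul]
  · rw [sum_comm]
    refine sum_congr rfl fun y hy => ?_
    rw [h.degree_eq' hy, ← sum_filter, sum_const, nsmul_eq_mul]

/-- With pair weights positive on edges and negative on non-edges, H is the only graph of maximum
total weight, yet that total depends only on the degrees. -/
theorem HasNestedNeighborhoods.isUniqueRealization {H : SimpleGraph V} [DecidableRel H.Adj]
    {X Y : Finset V} (h : IsBipartition H X Y) (hN : HasNestedNeighborhoods H X) :
    IsUniqueRealization H X Y := by
  intro G _ hG hdeg
  obtain ⟨a, b, -, -, hab⟩ := hN.exists_weights h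
  -- The pair weight is 2(a(y) - b(x)) - 1: odd, hence never zero, and positive iff b(x) < a(y).
  let f : V → ℤ := fun v => -2 * (b v : ℤ) - 1
  let g : V → ℤ := fun v => 2 * (a v : ℤ)
  have hpos : ∀ x ∈ X, ∀ y ∈ Y, H.Adj x y → 0 < f x + g y := by
    intro x hx y hy hxy
    have := (hab x hx y hy).mp hxy
    simp only [f, g]
    omega
  have hneg : ∀ x ∈ X, ∀ y ∈ Y, ¬ H.Adj x y → f x + g y < 0 := by
    intro x hx y hy hxy
    have := (not_congr (hab x hx y hy)).mp hxy
    simp only [f, g]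
    omega
  have hle : ∀ x ∈ X, ∀ y ∈ Y, (if G.Adj x y then f x + g y else 0) ≤
      (if H.Adj x y then f x + g y else 0) := by
    intro x hx y hy
    by_cases hH : H.Adj x y
    · have := hpos x hx y hy hH
      split_ifs <;> omega
    · have := hneg x hx y hy hH
      split_ifs <;> omega
  have hsum : ∑ x ∈ X, ∑ y ∈ Y, (if G.Adj x y then f x + g y else 0) =
      ∑ x ∈ X, ∑ y ∈ Y, (if H.Adj x y then f x + g y else 0) := by
    rw [h.sum_edge_weights, hG.sum_edge_weights]
    simp only [hdeg]
  have heq : ∀ x ∈ X, ∀ y ∈ Y, (G.Adj x y ↔ H.Adj x y) := by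
    intro x hx y hy
    have h1 := (sum_eq_sum_iff_of_le fun x hx => sum_le_sum (hle x hx)).mp hsum x hx
    have h2 := (sum_eq_sum_iff_of_le (hle x hx)).mp h1 y hy
    by_cases hH : H.Adj x y
    · have := hpos x hx y hy hH
      by_cases hG' : G.Adj x y
      · exact iff_of_true hG' hH
      · rw [if_neg hG', if_pos hH] at h2
        omega
    · have := hneg x hx y hy hH
      by_cases hG' : G.Adj x y
      · rw [if_pos hG', if_neg hH] at h2
        omega
      · exact iff_of_false hG' hH
  ext u v
  rcases h.2 u with hu | hu <;> rcases h.2 v with hv | hv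
  · exact iff_of_false (hG.not_adj_left hu hv) (h.not_adj_left hu hv)
  · exact heq u hu v hv
  · rw [G.adj_comm, H.adj_comm]
    exact heq v hv u hu
  · exact iff_of_false (hG.symm.not_adj_left hu hv) (h.symm.not_adj_left hu hv)

end Nested

/-! ### Degree-preserving switches -/

section Switch

variable {V : Type*}

/-- The graph obtained from `H` by replacing the edges `xy`, `x'y'` by `xy'`, `x'y`. -/
def switch (H : SimpleGraph V) (x y x' y' : V) : SimpleGraph V :=
  SimpleGraph.fromEdgeSet ((H.edgeSet \ {s(x, y), s(x', y')}) ∪ {s(x, y'), s(x', y)})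

theorem switch_adj {H : SimpleGraph V} {x y x' y' : V} (hxy' : x ≠ y') (hx'y : x' ≠ y)
    (u v : V) :
    (switch H x y x' y').Adj u v ↔
      (H.Adj u v ∧ s(u, v) ≠ s(x, y) ∧ s(u, v) ≠ s(x', y')) ∨
        s(u, v) = s(x, y') ∨ s(u, v) = s(x', y) := by
  simp only [switch, SimpleGraph.fromEdgeSet_adj, Set.mem_union, Set.mem_sdiff,
    SimpleGraph.mem_edgeSet, Set.mem_insert_iff, Set.mem_singleton_iff, not_or]
  refine ⟨And.left, fun h => ⟨h, ?_⟩⟩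
  rintro rfl
  rcases h with h | h | h
  · exact h.1.ne rfl
  · simp only [Sym2.eq_iff] at h
    aesop
  · simp only [Sym2.eq_iff] at h
    aesop

/-- Trading one neighbor for another keeps the degree; this serves all four corners of a switch. -/
theorem degree_switch_left [Fintype V] {H G : SimpleGraph V} [DecidableRel H.Adj]
    [DecidableRel G.Adj] {x y y' : V} (hy : H.Adj x y) (hy' : ¬ H.Adj x y')
    (hG : ∀ v, G.Adj x v ↔ (H.Adj x v ∧ v ≠ y) ∨ v = y') : G.degree x = H.degree x := by
  classical
  have hG' : G.neighborFinset x = insert y' ((H.neighborFinset x).erase y) := by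
    ext v
    simp only [SimpleGraph.mem_neighborFinset, hG, mem_insert, mem_erase]
    tauto
  rw [← SimpleGraph.card_neighborFinset_eq_degree, hG', card_insert_of_notMem (by simp [hy']),
    card_erase_add_one (by simpa using hy), SimpleGraph.card_neighborFinset_eq_degree]

theorem IsUniqueRealization.hasNestedNeighborhoods [Fintype V] {H : SimpleGraph V}
    [DecidableRel H.Adj] {X Y : Finset V} (h : IsBipartition H X Y)
    (hU : IsUniqueRealization H X Y) : HasNestedNeighborhoods H X := by
  classical
  intro x x' y y' hx hx' hxy hxy'
  by_contra! hcon
  have hy := h.mem_right hx hxy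
  have hy' := h.mem_right hx' hxy'
  have ne1 : x ≠ y := fun e => h.notMem_right hx (e ▸ hy)
  have ne2 : x ≠ y' := fun e => h.notMem_right hx (e ▸ hy')
  have ne3 : x' ≠ y := fun e => h.notMem_right hx' (e ▸ hy)
  have ne4 : x' ≠ y' := fun e => h.notMem_right hx' (e ▸ hy')
  have ne5 : x ≠ x' := fun e => hcon.1 (e ▸ hxy')
  have ne6 : y ≠ y' := fun e => hcon.1 (e ▸ hxy)
  have hadj := switch_adj (H := H) (x := x) (y := y) (x' := x') (y' := y') ne2 ne3
  have hne : switch H x y x' y' ≠ H := by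
    intro e
    exact hcon.1 (e ▸ (hadj x y').mpr (Or.inr (Or.inl rfl)))
  refine hne (hU _ ⟨⟨h.1.disjoint, ?_⟩, h.2⟩ fun v => ?_)
  · intro u v huv
    simp only [mem_coe]
    rcases (hadj u v).mp huv with huv | huv | huv
    · exact h.1.mem_of_adj huv.1
    · rcases Sym2.eq_iff.mp huv with ⟨rfl, rfl⟩ | ⟨rfl, rfl⟩
      · exact Or.inl ⟨hx, hy'⟩
      · exact Or.inr ⟨hy', hx⟩
    · rcases Sym2.eq_iff.mp huv with ⟨rfl, rfl⟩ | ⟨rfl, rfl⟩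
      · exact Or.inl ⟨hx', hy⟩
      · exact Or.inr ⟨hy, hx'⟩
  · by_cases h1 : v = x
    · subst h1
      refine degree_switch_left hxy hcon.1 fun z => ?_
      rw [hadj]
      simp only [ne_eq, Sym2.eq_iff, ne1, ne2, ne5, true_and, false_and, or_false,
        not_false_eq_true, and_true]
    by_cases h2 : v = x'
    · subst h2
      refine degree_switch_left hxy' hcon.2 fun z => ?_
      rw [hadj]
      simp only [ne_eq, Sym2.eq_iff, ne3, ne4, ne5.symm, true_and, false_and, or_false,
        false_or, not_false_eq_true]
    by_cases h3 : v = y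
    · subst h3
      refine degree_switch_left hxy.symm (fun e => hcon.2 e.symm) fun z => ?_
      rw [hadj]
      simp only [ne_eq, Sym2.eq_iff, ne6, ne1.symm, ne3.symm, true_and, false_and, or_false,
        false_or, not_false_eq_true, and_true]
    by_cases h4 : v = y'
    · subst h4
      refine degree_switch_left hxy'.symm (fun e => hcon.1 e.symm) fun z => ?_
      rw [hadj]
      simp only [ne_eq, Sym2.eq_iff, ne2.symm, ne4.symm, ne6.symm, true_and, false_and, or_false,
        false_or, not_false_eq_true]
    · rw [← SimpleGraph.card_neighborFinset_eq_degree,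
        ← SimpleGraph.card_neighborFinset_eq_degree]
      congr 1
      ext z
      simp only [SimpleGraph.mem_neighborFinset, hadj, ne_eq, Sym2.eq_iff, h1, h2, h3, h4,
        false_and, or_false, not_false_eq_true, and_true]

end Switch

/-! ### Degree lists and tightness of the Gale–Ryser bound -/

section DegreeList

variable {V : Type*} [Fintype V]

theorem pairwise_degreeList (H : SimpleGraph V) [DecidableRel H.Adj] (S : Finset V) :
    (degreeList H S).Pairwise (· ≥ ·) :=
  Multiset.pairwise_sort _ _

theorem coe_degreeList (H : SimpleGraph V) [DecidableRel H.Adj] (S : Finset V) :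
    (degreeList H S : Multiset ℕ) = S.val.map fun v => H.degree v :=
  Multiset.sort_eq _ _

theorem length_degreeList (H : SimpleGraph V) [DecidableRel H.Adj] (S : Finset V) :
    (degreeList H S).length = #S := by
  rw [← Multiset.coe_card, coe_degreeList, Multiset.card_map, card_val]

theorem sum_map_degreeList (H : SimpleGraph V) [DecidableRel H.Adj] (S : Finset V)
    (f : ℕ → ℕ) : ((degreeList H S).map f).sum = ∑ v ∈ S, f (H.degree v) := by
  rw [← Multiset.sum_coe, ← Multiset.map_coe, coe_degreeList, Multiset.map_map]
  rfl

theorem sum_degreeList (H : SimpleGraph V) [DecidableRel H.Adj] (S : Finset V) :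
    (degreeList H S).sum = ∑ v ∈ S, H.degree v := by
  simpa using sum_map_degreeList H S id

theorem mem_degreeList {H : SimpleGraph V} [DecidableRel H.Adj] {S : Finset V} {d : ℕ} :
    d ∈ degreeList H S ↔ ∃ v ∈ S, H.degree v = d := by
  rw [← Multiset.mem_coe, coe_degreeList, Multiset.mem_map]
  rfl

/-- The vertices of `S` can be listed by descending degree. -/
theorem exists_list_map_degree_eq (H : SimpleGraph V) [DecidableRel H.Adj] (S : Finset V) :
    ∃ L : List V, L.Nodup ∧ (∀ v, v ∈ L ↔ v ∈ S) ∧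
      L.map (fun v => H.degree v) = degreeList H S := by
  have hperm := List.mergeSort_perm S.toList fun u v => decide (H.degree v ≤ H.degree u)
  refine ⟨S.toList.mergeSort fun u v => decide (H.degree v ≤ H.degree u),
    hperm.nodup_iff.mpr S.nodup_toList, fun v => by rw [hperm.mem_iff, mem_toList], ?_⟩
  refine List.Perm.eq_of_pairwise (le := (· ≥ ·)) (fun a b _ _ h1 h2 => le_antisymm h2 h1) ?_
    (pairwise_degreeList H S) ?_
  · rw [List.pairwise_map]
    refine (List.pairwise_mergeSort (fun a b c h1 h2 => ?_) (fun a b => ?_) S.toList).imp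
      fun h => by simpa using h
    · simp only [decide_eq_true_eq] at *
      exact h2.trans h1
    · simpa using le_total (H.degree b) (H.degree a)
  · rw [← Multiset.coe_eq_coe, coe_degreeList, ← Multiset.map_coe, Multiset.coe_eq_coe.mpr hperm,
      coe_toList]

theorem IsBipartition.sum_degree_eq {H : SimpleGraph V} [DecidableRel H.Adj] {X Y S : Finset V}
    (h : IsBipartition H X Y) (hS : S ⊆ X) :
    ∑ x ∈ S, H.degree x = ∑ y ∈ Y, #{x ∈ S | H.Adj x y} := by
  rw [sum_congr rfl fun x hx => h.degree_eq (hS hx)]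
  simp only [card_filter]
  exact sum_comm

/-- Equality holds in the Gale–Ryser bound for a set `S` of vertices of `X` iff `S` is comparable
with the neighborhood of every vertex of `Y`. -/
theorem IsBipartition.sum_degree_eq_sum_min_iff {H : SimpleGraph V} [DecidableRel H.Adj]
    {X Y S : Finset V} (h : IsBipartition H X Y) (hS : S ⊆ X) :
    ∑ x ∈ S, H.degree x = ∑ y ∈ Y, min #S (H.degree y) ↔
      ∀ y ∈ Y, (∀ x ∈ S, H.Adj x y) ∨ ∀ x ∈ X, H.Adj x y → x ∈ S := by
  have hsub : ∀ y, ({x ∈ S | H.Adj x y} : Finset V) ⊆ {x ∈ X | H.Adj x y} :=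
    fun y => filter_subset_filter _ hS
  -- Counted from Y, the inequality holds term by term, so equal sums force equality at every y.
  rw [h.sum_degree_eq hS, sum_eq_sum_iff_of_le fun y hy => le_min (card_filter_le _ _)
    ((card_le_card (hsub y)).trans_eq (h.degree_eq' hy).symm)]
  refine forall₂_congr fun y hy => ?_
  rw [h.degree_eq' hy]
  constructor
  · intro he
    rcases min_choice #S #{x ∈ X | H.Adj x y} with hm | hm <;> rw [hm] at he
    · exact Or.inl (card_filter_eq_iff.mp he)
    · refine Or.inr fun x hx hxy => ?_
      have := eq_of_subset_of_card_le (hsub y) he.ge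
      have hmem : x ∈ ({x ∈ X | H.Adj x y} : Finset V) := mem_filter.mpr ⟨hx, hxy⟩
      rw [← this] at hmem
      exact (mem_filter.mp hmem).1
  · rintro (hall | hall)
    · have he := card_filter_eq_iff.mpr hall
      rw [he, min_eq_left]
      rw [← he]
      exact card_le_card (hsub y)
    · have he : ({x ∈ S | H.Adj x y} : Finset V) = {x ∈ X | H.Adj x y} :=
        (hsub y).antisymm fun x hx =>
          mem_filter.mpr ⟨hall x (mem_filter.mp hx).1 (mem_filter.mp hx).2, (mem_filter.mp hx).2⟩
      rw [← he, min_eq_right (card_filter_le _ _)]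

theorem IsBipartition.sum_degreeList_eq {H : SimpleGraph V} [DecidableRel H.Adj]
    {X Y : Finset V} (h : IsBipartition H X Y) :
    (degreeList H X).sum = (degreeList H Y).sum := by
  rw [sum_degreeList, sum_degreeList, h.sum_degree_eq Subset.rfl]
  exact sum_congr rfl fun y hy => (h.degree_eq' hy).symm

theorem hasNestedNeighborhoods_iff_galeRyserEquality {H : SimpleGraph V} [DecidableRel H.Adj]
    {X Y : Finset V} (h : IsBipartition H X Y) :
    HasNestedNeighborhoods H X ↔ GaleRyserEquality (degreeList H X) (degreeList H Y) := by
  classical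
  obtain ⟨L, hnd, hmem, hL⟩ := exists_list_map_degree_eq H X
  have hlen : L.length = (degreeList H X).length := by rw [← hL, List.length_map]
  have hsub : ∀ k, (L.take k).toFinset ⊆ X := fun k v hv =>
    (hmem v).mp (List.mem_of_mem_take (List.mem_toFinset.mp hv))
  have hcard : ∀ k ≤ L.length, #(L.take k).toFinset = k := fun k hk => by
    rw [List.toFinset_card_of_nodup (hnd.sublist (List.take_sublist _ _)), List.length_take,
      min_eq_left hk]
  have hiff : ∀ k ≤ L.length, ((degreeList H X).take k).sum =
      ((degreeList H Y).map fun r => min k r).sum ↔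
      ∀ y ∈ Y, (∀ x ∈ (L.take k).toFinset, H.Adj x y) ∨
        ∀ x ∈ X, H.Adj x y → x ∈ (L.take k).toFinset := by
    intro k hk
    rw [← h.sum_degree_eq_sum_min_iff (hsub k), hcard k hk, sum_map_degreeList, ← hL,
      ← List.map_take, List.sum_toFinset _ (hnd.sublist (List.take_sublist _ _))]
  constructor
  · intro hN
    refine ⟨h.sum_degreeList_eq, fun k _ hk => (hiff k (by omega)).mpr fun y hy => ?_⟩
    by_contra! hcon
    obtain ⟨⟨x, hx, hxy⟩, x', hx', hxy', hx'S⟩ := hcon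
    refine hxy (hN.adj_of_degree_le hx' (hsub k hx) hxy' ?_)
    have hsort : L.Pairwise fun u v => H.degree u ≥ H.degree v := by
      have := pairwise_degreeList H X
      rwa [← hL, List.pairwise_map] at this
    rw [← List.take_append_drop k L, List.pairwise_append] at hsort
    refine hsort.2.2 x (List.mem_toFinset.mp hx) x' ?_
    have := (hmem x').mpr hx'
    rw [← List.take_append_drop k L, List.mem_append] at this
    exact this.resolve_left fun h' => hx'S (List.mem_toFinset.mpr h')
  · rintro ⟨-, hG⟩
    have key : ∀ i j : ℕ, ∀ (hi : i < L.length) (hj : j < L.length), i < j → ∀ y,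
        H.Adj L[j] y → H.Adj L[i] y := by
      intro i j hi hj hij y hjy
      have hjX : L[j] ∈ X := (hmem _).mp (List.getElem_mem hj)
      -- The first i + 1 vertices include `L[i]` but not `L[j]`. As `L[j]` is a neighbor of y
      -- outside this segment, comparability puts the whole segment in N(y).
      have hkey := (hiff (i + 1) hi).mp (hG (i + 1) (by omega) (by omega)) y
        (h.mem_right hjX hjy)
      rcases hkey with hkey | hkey
      · refine hkey _ (List.mem_toFinset.mpr ?_)
        rw [List.mem_take_iff_getElem]
        exact ⟨i, by omega, rfl⟩
      · have hjS := List.mem_toFinset.mp (hkey _ hjX hjy)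
        rw [List.mem_take_iff_getElem] at hjS
        obtain ⟨m, hm, hmj⟩ := hjS
        have := (hnd.getElem_inj_iff).mp hmj
        omega
    intro x x' y y' hx hx' hxy hxy'
    obtain ⟨i, hi, rfl⟩ := List.mem_iff_getElem.mp ((hmem x).mpr hx)
    obtain ⟨j, hj, rfl⟩ := List.mem_iff_getElem.mp ((hmem x').mpr hx')
    rcases lt_trichotomy i j with hij | rfl | hij
    · exact Or.inl (key i j hi hj hij y' hxy')
    · exact Or.inl hxy'
    · exact Or.inr (key j i hj hi hij y hxy)

end DegreeList

/-! ### Bipartitions of difference graphs and the main equivalence -/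

theorem IsDifferenceGraph.exists_isBipartition {V : Type*} [Fintype V] {H : SimpleGraph V}
    [DecidableRel H.Adj] (hD : IsDifferenceGraph H) :
    ∃ X Y : Finset V, IsBipartition H X Y ∧ ∀ x ∈ X, H.degree x ≤ #X := by
  classical
  obtain ⟨t, w, ht, hwt, hw⟩ := hD
  obtain ⟨X, Y, h⟩ : ∃ X Y : Finset V, IsBipartition H X Y := by
    -- Split by the sign of the weight: since |w| < t, weights on the same side differ by less than
    -- t.
    refine ⟨univ.filter fun v => 0 ≤ w v, univ.filter fun v => w v < 0, ⟨?_, ?_⟩, ?_⟩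
    · rw [disjoint_coe, disjoint_filter]
      exact fun v _ h1 h2 => absurd h1 (not_le.mpr h2)
    · intro u v huv
      have h1 := (hw u v huv.ne).mp huv
      have hu := abs_lt.mp (hwt u)
      have hv := abs_lt.mp (hwt v)
      simp only [coe_filter, mem_univ, true_and, Set.mem_ofPred_eq]
      rcases le_or_gt 0 (w u) with h2 | h2 <;> rcases le_or_gt 0 (w v) with h3 | h3
      · rcases le_abs.mp h1 with h1 | h1 <;> linarith
      · exact Or.inl ⟨h2, h3⟩
      · exact Or.inr ⟨h2, h3⟩
      · rcases le_abs.mp h1 with h1 | h1 <;> linarith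
    · intro v
      simpa using le_or_gt 0 (w v)
  -- Degrees in one side are at most the size of the other, so the larger side is taken as X.
  rcases le_total #Y #X with hle | hle
  · exact ⟨X, Y, h, fun x hx => (h.degree_eq hx).trans_le ((card_filter_le _ _).trans hle)⟩
  · exact ⟨Y, X, h.symm, fun x hx =>
      (h.symm.degree_eq hx).trans_le ((card_filter_le _ _).trans hle)⟩

end BipartiteDegrees

theorem mainTheorem4 {V : Type*} [Fintype V] (H : SimpleGraph V) [DecidableRel H.Adj] :
    (∀ X Y : Finset V, BipartiteDegrees.IsBipartition H X Y →
      (∀ x ∈ X, H.degree x ≤ X.card) →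
      List.TFAE
        [BipartiteDegrees.IsDifferenceGraph H,
          BipartiteDegrees.IsUniqueRealization H X Y,
          BipartiteDegrees.IsThresholdGraph (BipartiteDegrees.augment H X),
          BipartiteDegrees.IsThresholdGraph (BipartiteDegrees.augment H Y),
          BipartiteDegrees.GaleRyserEquality
            (BipartiteDegrees.degreeList H X) (BipartiteDegrees.degreeList H Y),
          BipartiteDegrees.SameDiagram
            (BipartiteDegrees.conjugate (BipartiteDegrees.degreeList H X))
            (BipartiteDegrees.degreeList H Y)]) ∧
    (BipartiteDegrees.IsDifferenceGraph H →
      ∃ X Y : Finset V, BipartiteDegrees.IsBipartition H X Y ∧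
        ∀ x ∈ X, H.degree x ≤ X.card) := by
  open BipartiteDegrees in
  refine ⟨fun X Y h _ => ?_, fun hD => hD.exists_isBipartition⟩
  have h0 : IsDifferenceGraph H ↔ HasNestedNeighborhoods H X :=
    ⟨fun hD => hD.hasNestedNeighborhoods h, fun hN => hN.isDifferenceGraph h⟩
  have h1 : IsUniqueRealization H X Y ↔ HasNestedNeighborhoods H X :=
    ⟨fun hU => hU.hasNestedNeighborhoods h, fun hN => hN.isUniqueRealization h⟩
  have h2 : IsThresholdGraph (augment H X) ↔ HasNestedNeighborhoods H X :=
    ⟨fun hT => hT.hasNestedNeighborhoods h, fun hN => hN.isThresholdGraph h⟩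
  have h2' : IsThresholdGraph (augment H Y) ↔ HasNestedNeighborhoods H X :=
    ⟨fun hT => (hT.hasNestedNeighborhoods h.symm).swap h.symm,
      fun hN => (hN.swap h).isThresholdGraph h.symm⟩
  have h3 := hasNestedNeighborhoods_iff_galeRyserEquality h
  have h4 : GaleRyserEquality (degreeList H X) (degreeList H Y) ↔
      SameDiagram (conjugate (degreeList H X)) (degreeList H Y) := by
    refine galeRyserEquality_iff_sameDiagram_conjugate (pairwise_degreeList H X)
      (pairwise_degreeList H Y) h.sum_degreeList_eq fun r hr => ?_
    obtain ⟨y, hy, rfl⟩ := mem_degreeList.mp hr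
    rw [length_degreeList, h.degree_eq' hy]
    exact Finset.card_filter_le _ _
  tfae_have 1 ↔ 2 := h0.trans h1.symm
  tfae_have 1 ↔ 3 := h0.trans h2.symm
  tfae_have 1 ↔ 4 := h0.trans h2'.symm
  tfae_have 1 ↔ 5 := h0.trans h3
  tfae_have 5 ↔ 6 := h4
  tfae_finish
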